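/- Let $k$ be a field of characteristic $0$ and let $n > 1$ be an integer. Let $S_n$ be the group of permutations of $\{1,\dots,n\}$, with product $(uv)(i)=u(v(i))$, and let $k[S_n]$ be its group algebra. Let $w_0 \in S_n$ be the permutation $i \mapsto n+1-i$, and let $$A = \sum_{i=1}^{n} \operatorname{cyc}_{1,2,\dots,i} \in k[S_n]$$ be the top-to-random shuffle, where $\operatorname{cyc}_{1,2,\dots,i}$ is the cycle $1 \mapsto 2 \mapsto \cdots \mapsto i \mapsto 1$ (the identity for $i=1$). Let $$L(n) = \{-n+2\} \cup \{m \in \mathbb{Z} : -n+4 \le m \le n-3\} \cup \{0\} \cup \{n\}.$$ Then the elements $w_0A$ and $Aw_0$ of the $k$-algebra $k[S_n]$ both have minimal polynomial $$\prod_{m \in L(n)} (x-m) \in k[x],$$ where the product runs over the set $L(n)$, so that each $m\in L(n)$ contributes exactly one factor. In particular, each of the elements $w_0A$ and $Aw_0$, acting on $k[S_n]$ either by left multiplication or by right multiplication, is a diagonalizable $k$-linear endomorphism whose set of eigenvalues is exactly $L(n)$ (regarded as a subset of $k$). -/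

import Mathlib

open Polynomial

noncomputable section

namespace RevTopToRandom

/-- The group algebra `K[S_n]`. The deck positions `1, …, n` are modelled by `Fin n = {0, …, n-1}`
(so `i` in `Fin n` stands for the number `i + 1`); the product of permutations is composition,
`(u * v) i = u (v i)`. -/
abbrev SymAlg (K : Type*) [Field K] (n : ℕ) : Type _ :=
  MonoidAlgebra K (Equiv.Perm (Fin n))

/-- The longest element `w₀` of `S_n`, with one-line notation `(n, n-1, …, 1)`, viewed in
the group algebra. -/
def longest (K : Type*) [Field K] (n : ℕ) : SymAlg K n :=
  MonoidAlgebra.of K (Equiv.Perm (Fin n)) Fin.revPerm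

/-- The top-to-random shuffle `A`, the sum over `i = 1, …, n` of the cycles
`1 ↦ 2 ↦ ⋯ ↦ i ↦ 1`. -/
def topToRandom (K : Type*) [Field K] (n : ℕ) : SymAlg K n :=
  ∑ i : Fin n, MonoidAlgebra.of K (Equiv.Perm (Fin n)) (Fin.cycleRange i)

/-- The set of integers `L(n) = {-n+2} ∪ [-n+4, n-3] ∪ {0} ∪ {n}`; the interval is empty if
`-n+4 > n-3`. -/
def specSet (n : ℕ) : Finset ℤ :=
  {-(n : ℤ) + 2} ∪ Finset.Icc (-(n : ℤ) + 4) ((n : ℤ) - 3) ∪ {0} ∪ {(n : ℤ)}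

/-- An endomorphism is diagonalizable if there is a basis consisting of eigenvectors. -/
def IsDiagonalizable {K V : Type*} [Field K] [AddCommGroup V] [Module K V]
    (f : Module.End K V) : Prop :=
  ∃ (s : Set V) (b : Module.Basis s K V), ∀ i : s, ∃ c : K, f (b i) = c • b i

/-- The endomorphism `f` is diagonalizable, and its eigenvalues in `K` are exactly the images of
the elements of `L`. -/
def DiagonalizableWithEigenvalues {K V : Type*} [Field K] [AddCommGroup V] [Module K V]
    (f : Module.End K V) (L : Finset ℤ) : Prop :=
  IsDiagonalizable f ∧ ∀ c : K, f.HasEigenvalue c ↔ ∃ m ∈ L, (m : K) = c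

end RevTopToRandom

end

/-! The group algebra acts by permuting positions on functions on words of length `n`, i.e. on
noncommutative polynomials of degree `n`. There `A` becomes the Euler operator `E = ∑ x_i ∂_i`,
where `∂_i` is the derivation with `∂_i x_j = δ_ij`, and `w₀` becomes reversal `rev`, which commutes
with each `∂_i`.

Since `[∂_i, E] = ∂_i`, every `a`-fold derivation `D` satisfies `D E = E D + a D`. Filter
polynomials by the number of derivations needed to kill them. If all `(a+1)`-fold derivations kill
`f`, then `D f` is a constant (killed by every `∂_i`) of degree `n - a`, and `D (rev E f) = a · rev
(D f)` (`ders_revEuler`). Hence `rev E` acts on the `a`-th layer as `a` times reversal of constants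
of degree `d = n - a`. Reversal is `1` for `d = 0`, there are no nonzero constants for `d = 1`, it
is `-1` for `d = 2` and `1` for `d = 3`, and both signs occur for `d ≥ 4`. The resulting values `±a`
form exactly `L(n)`, each needed only once because values with different `|m|` live on different
layers.

Conversely, let `u` be a nonzero constant of degree `d` with `rev u = ε u`. Applying `∂_0^a` to
`p(rev E)(x_0^a u)` gives `a! p(εa) u`, so in characteristic `0` every annihilating `p` vanishes at
`εa`. Four letters suffice for the required `u` (`exists_rev_eq_smul`). Faithfulness of the action
transfers the result to `w₀A`; conjugation by `w₀` gives `Aw₀`. -/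

namespace RevTopToRandom

/-! ### Derivations, reversal and the Euler operator on word functions. -/

section Words

variable {K : Type*} [Field K] {X : Type*}

/-- The sum of the values of `f` at all words obtained by inserting the letter `i` into a word.
Viewing `f` as a noncommutative power series, this is the derivation which sends the letter `i`
to `1` and the other letters to `0`. -/
def insSum (i : X) : (List X → K) → List X → K
  | f, [] => f [i]
  | f, x :: w => f (i :: x :: w) + insSum i (fun v => f (x :: v)) w

theorem insSum_add (i : X) (f g : List X → K) (w : List X) :
    insSum i (f + g) w = insSum i f w + insSum i g w := by
  induction w generalizing f g with
  | nil => rfl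
  | cons x w ih =>
    have := ih (fun v => f (x :: v)) (fun v => g (x :: v))
    simp only [insSum, Pi.add_apply] at this ⊢
    rw [add_add_add_comm, ← this]
    rfl

theorem insSum_smul (i : X) (c : K) (f : List X → K) (w : List X) :
    insSum i (c • f) w = c * insSum i f w := by
  induction w generalizing f with
  | nil => rfl
  | cons x w ih =>
    have := ih (fun v => f (x :: v))
    simp only [insSum, Pi.smul_apply, smul_eq_mul] at this ⊢
    rw [mul_add, ← this]
    rfl

/-- `insSum` as a linear map. -/
def der (i : X) : Module.End K (List X → K) where
  toFun f := insSum i f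
  map_add' f g := funext (insSum_add i f g)
  map_smul' c f := funext (insSum_smul i c f)

theorem der_nil (i : X) (f : List X → K) : der i f [] = f [i] := rfl

theorem der_cons (i x : X) (f : List X → K) (w : List X) :
    der i f (x :: w) = f (i :: x :: w) + der i (fun v => f (x :: v)) w := rfl

theorem der_comm (i j : X) (f : List X → K) : der i (der j f) = der j (der i f) := by
  funext w
  induction w generalizing f with
  | nil => simp [der_nil, der_cons, add_comm]
  | cons x w ih =>
    have h (j : X) : (fun v => der j f (x :: v)) =
        (fun v => f (j :: x :: v)) + der j (fun v => f (x :: v)) := rfl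
    rw [der_cons i x (der j f), der_cons j x (der i f), h, h, map_add, map_add, Pi.add_apply,
      Pi.add_apply, ih, der_cons, der_cons, der_cons, der_cons]
    ring

/-- Reversal of words. -/
def rev : Module.End K (List X → K) where
  toFun f w := f w.reverse
  map_add' _ _ := rfl
  map_smul' _ _ := rfl

theorem rev_apply (f : List X → K) (w : List X) : rev f w = f w.reverse := rfl

theorem rev_rev (f : List X → K) : rev (rev f) = f := by
  funext w; simp [rev_apply]

theorem der_append_singleton (i x : X) (f : List X → K) (w : List X) :
    der i f (w ++ [x]) = f (w ++ [x, i]) + der i (fun v => f (v ++ [x])) w := by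
  induction w generalizing f with
  | nil => simp [der_nil, der_cons, add_comm]
  | cons y w ih =>
    simp only [List.cons_append, der_cons, ih]
    ring

theorem der_rev (i : X) (f : List X → K) : der i (rev f) = rev (der i f) := by
  funext w
  induction w generalizing f with
  | nil => rfl
  | cons x w ih =>
    have h : (fun v => rev f (x :: v)) = rev (fun v => f (v ++ [x])) := by
      funext v; simp [rev_apply]
    rw [der_cons, h, ih]
    simp [rev_apply, der_append_singleton]

/-- The Euler operator: the sum over all letters `i` of the operators "apply the derivation
`der i`, then multiply by `i` from the left". -/
def euler : Module.End K (List X → K) where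
  toFun f
    | [] => 0
    | i :: w => der i f w
  map_add' f g := by
    funext w
    cases w <;> simp
  map_smul' c f := by
    funext w
    cases w <;> simp

theorem euler_nil (f : List X → K) : euler f [] = 0 := rfl

theorem euler_cons (f : List X → K) (i : X) (w : List X) : euler f (i :: w) = der i f w := rfl

/-- Leibniz rule for `∑ x_j ∂_j`, using that the derivations commute. -/
theorem der_euler (i : X) (f : List X → K) : der i (euler f) = euler (der i f) + der i f := by
  funext w
  cases w with
  | nil => simp [der_nil, euler_nil, euler_cons]
  | cons j w =>
    rw [der_cons, euler_cons, Pi.add_apply, euler_cons, der_comm j i, add_comm]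
    rfl

theorem euler_eq_zero {f : List X → K} (hf : ∀ i, der i f = 0) : euler f = 0 := by
  funext w
  cases w with
  | nil => rfl
  | cons i w => rw [euler_cons, hf]; rfl

/-- The composition of the derivations belonging to the letters of a word. -/
def ders : List X → Module.End K (List X → K)
  | [] => 1
  | i :: s => ders s * der i

theorem ders_nil (f : List X → K) : ders [] f = f := rfl

theorem ders_cons (i : X) (s : List X) (f : List X → K) : ders (i :: s) f = ders s (der i f) := rfl

theorem der_ders (i : X) (s : List X) (f : List X → K) : der i (ders s f) = ders (i :: s) f := by
  induction s generalizing f with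
  | nil => rfl
  | cons j s ih => rw [ders_cons, ih, ders_cons, ders_cons, ders_cons, der_comm]

theorem ders_rev (s : List X) (f : List X → K) : ders s (rev f) = rev (ders s f) := by
  induction s generalizing f with
  | nil => rfl
  | cons j s ih => rw [ders_cons, ders_cons, der_rev, ih]

theorem ders_euler (s : List X) (f : List X → K) :
    ders s (euler f) = euler (ders s f) + (s.length : K) • ders s f := by
  induction s generalizing f with
  | nil => simp [ders_nil]
  | cons j s ih =>
    rw [ders_cons, der_euler, map_add, ih, ders_cons, List.length_cons]
    push_cast
    module

/-- The Euler operator followed by reversal. -/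
def revEuler : Module.End K (List X → K) := rev * euler

theorem revEuler_apply (f : List X → K) : revEuler f = rev (euler f) := rfl

/-- The functions supported on words of length `n` which are annihilated by all `a`-fold
derivations. -/
def filt (K X : Type*) [Field K] (n a : ℕ) : Submodule K (List X → K) where
  carrier := {f | (∀ w : List X, w.length ≠ n → f w = 0) ∧
    ∀ s : List X, s.length = a → ders s f = 0}
  add_mem' {f g} hf hg := ⟨fun w hw => by simp [hf.1 w hw, hg.1 w hw],
    fun s hs => by rw [map_add, hf.2 s hs, hg.2 s hs, add_zero]⟩
  zero_mem' := ⟨fun _ _ => rfl, fun _ _ => map_zero _⟩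
  smul_mem' c f hf := ⟨fun w hw => by simp [hf.1 w hw],
    fun s hs => by rw [map_smul, hf.2 s hs, smul_zero]⟩

variable {n a : ℕ} {f : List X → K}

theorem der_supported (i : X) (hf : ∀ w : List X, w.length ≠ n → f w = 0) (w : List X)
    (hw : w.length + 1 ≠ n) : der i f w = 0 := by
  induction w generalizing f n with
  | nil => exact hf [i] hw
  | cons x w ih =>
    rw [der_cons, hf _ (by simpa using hw), zero_add]
    refine ih (n := n - 1) (fun v hv => hf _ ?_) ?_
    · simp only [List.length_cons]; omega
    · simp only [List.length_cons] at hw; omega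

theorem ders_supported (s : List X) (hf : ∀ w : List X, w.length ≠ n → f w = 0) (w : List X)
    (hw : w.length + s.length ≠ n) : ders s f w = 0 := by
  induction s generalizing f w n with
  | nil => exact hf w hw
  | cons x s ih =>
    simp only [List.length_cons] at hw
    cases n with
    | zero =>
      -- For `n = 0` the derivative vanishes everywhere, so any length other than `w.length +
      -- s.length` serves as its support.
      exact ih (n := w.length + s.length + 1) (fun v _ => der_supported x hf v (by omega)) w
        (by omega)
    | succ n => exact ih (n := n) (fun v hv => der_supported x hf v (by omega)) w (by omega)

theorem euler_supported (hf : ∀ w : List X, w.length ≠ n → f w = 0) (w : List X)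
    (hw : w.length ≠ n) : euler f w = 0 := by
  cases w with
  | nil => rfl
  | cons i w => exact der_supported i hf w hw

theorem rev_mem_filt (hf : f ∈ filt K X n a) : rev f ∈ filt K X n a :=
  ⟨fun w hw => hf.1 _ (by simpa using hw), fun s hs => by rw [ders_rev, hf.2 s hs, map_zero]⟩

theorem revEuler_mem_filt (hf : f ∈ filt K X n a) : revEuler f ∈ filt K X n a := by
  refine rev_mem_filt ⟨euler_supported hf.1, fun s hs => ?_⟩
  rw [ders_euler, hf.2 s hs]
  simp

theorem der_ders_of_mem_filt (hf : f ∈ filt K X n (a + 1)) {s : List X} (hs : s.length = a)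
    (i : X) : der i (ders s f) = 0 := by
  rw [der_ders]; exact hf.2 _ (by simp [hs])

theorem ders_revEuler (hf : f ∈ filt K X n (a + 1)) {s : List X} (hs : s.length = a) :
    ders s (revEuler f) = (a : K) • rev (ders s f) := by
  rw [revEuler_apply, ders_rev, ders_euler, euler_eq_zero (der_ders_of_mem_filt hf hs), zero_add,
    map_smul, hs]

theorem filt_zero_eq_bot : filt K X n 0 = ⊥ := by
  rw [eq_bot_iff]
  exact fun f hf => hf.2 [] rfl

theorem mem_filt_of_supported (hf : ∀ w : List X, w.length ≠ n → f w = 0) :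
    f ∈ filt K X n (n + 1) :=
  ⟨hf, fun s hs => funext fun w => ders_supported s hf w (by omega)⟩

/-- If reversal has the single sign `ε` on the constants reached from `f`, one linear factor lowers
the filtration. -/
theorem revEuler_sub_mem_filt_of_rev (ε : K) (hf : f ∈ filt K X n (a + 1))
    (h : ∀ s : List X, s.length = a → rev (ders s f) = ε • ders s f) :
    revEuler f - (ε * a) • f ∈ filt K X n a := by
  refine ⟨((filt K X n (a + 1)).sub_mem (revEuler_mem_filt hf)
    ((filt K X n (a + 1)).smul_mem _ hf)).1, fun s hs => ?_⟩
  rw [map_sub, ders_revEuler hf hs, map_smul, h s hs]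
  module

theorem revEuler_mem_filt_zero (hf : f ∈ filt K X n 1) : revEuler f = 0 := by
  have := revEuler_mem_filt hf
  have h : revEuler f ∈ filt K X n 0 := ⟨this.1, fun s hs => by
    rw [ders_revEuler hf hs]; simp⟩
  rwa [filt_zero_eq_bot] at h

/-- Reversal is an involution, so on each layer the square is `a²` with no knowledge of signs. -/
theorem revEuler_revEuler_sub_mem_filt (hf : f ∈ filt K X n (a + 1)) :
    revEuler (revEuler f) - ((a : K) * a) • f ∈ filt K X n a := by
  have h := revEuler_mem_filt hf
  refine ⟨((filt K X n (a + 1)).sub_mem (revEuler_mem_filt h)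
    ((filt K X n (a + 1)).smul_mem _ hf)).1, fun s hs => ?_⟩
  rw [map_sub, ders_revEuler h hs, ders_revEuler hf hs, map_smul, map_smul, rev_rev]
  module

theorem revEuler_sub_mem_filt_top (hf : f ∈ filt K X n (n + 1)) :
    revEuler f - (n : K) • f ∈ filt K X n n := by
  have := revEuler_sub_mem_filt_of_rev (n := n) 1 hf fun s hs => ?_
  · rwa [one_mul] at this
  · funext w
    cases w with
    | nil => simp [rev_apply]
    | cons x w =>
      have h := ders_supported s hf.1
      simp [rev_apply, h (x :: w) (by simp; omega), h (w.reverse ++ [x]) (by simp; omega)]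

theorem mem_filt_of_mem_filt_add_one (hf : f ∈ filt K X (n + 1) (n + 1)) :
    f ∈ filt K X (n + 1) n := by
  refine ⟨hf.1, fun s hs => funext fun w => ?_⟩
  -- A degree-one constant `g` vanishes, because `g [x]` is the value of `der x g` at the empty
  -- word.
  by_cases hw : w.length = 1
  · obtain ⟨x, rfl⟩ := List.length_eq_one_iff.1 hw
    exact congrFun (der_ders_of_mem_filt hf hs x) []
  · exact ders_supported s hf.1 w (by omega)

theorem rev_eq_neg_of_der_eq_zero (hf : ∀ w : List X, w.length ≠ 2 → f w = 0)
    (h : ∀ i, der i f = 0) : rev f = -f := by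
  funext w
  by_cases hw : w.length = 2
  · obtain ⟨x, y, rfl⟩ := List.length_eq_two.1 hw
    have := congrFun (h x) [y]
    simp only [der_cons, der_nil, Pi.zero_apply] at this
    simp only [rev_apply, Pi.neg_apply, List.reverse_cons, List.reverse_nil, List.nil_append,
      List.cons_append]
    linear_combination this
  · simp [rev_apply, hf w hw, hf w.reverse (by simpa using hw)]

theorem rev_eq_of_der_eq_zero (hf : ∀ w : List X, w.length ≠ 3 → f w = 0)
    (h : ∀ i, der i f = 0) : rev f = f := by
  funext w
  by_cases hw : w.length = 3
  · obtain ⟨x, y, z, rfl⟩ := List.length_eq_three.1 hw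
    -- Both relations contain `f [x, z, y] + f [z, x, y]`; subtracting leaves `f [z, y, x] = f [x,
    -- y, z]`.
    have h1 := congrFun (h x) [z, y]
    have h2 := congrFun (h z) [x, y]
    simp only [der_cons, der_nil, Pi.zero_apply] at h1 h2
    simp only [rev_apply, List.reverse_cons, List.reverse_nil, List.nil_append,
      List.cons_append]
    linear_combination h1 - h2
  · rw [rev_apply, hf w hw, hf w.reverse (by simpa using hw)]

theorem revEuler_add_mem_filt (hf : f ∈ filt K X (n + 2) (n + 1)) :
    revEuler f + (n : K) • f ∈ filt K X (n + 2) n := by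
  have := revEuler_sub_mem_filt_of_rev (-1) hf fun s hs => ?_
  · simpa using this
  · rw [neg_one_smul]
    exact rev_eq_neg_of_der_eq_zero (fun w hw => ders_supported s hf.1 w (by omega))
      (der_ders_of_mem_filt hf hs)

theorem revEuler_sub_mem_filt (hf : f ∈ filt K X (n + 3) (n + 1)) :
    revEuler f - (n : K) • f ∈ filt K X (n + 3) n := by
  have := revEuler_sub_mem_filt_of_rev 1 hf fun s hs => ?_
  · simpa using this
  · rw [one_smul]
    exact rev_eq_of_der_eq_zero (fun w hw => ders_supported s hf.1 w (by omega))
      (der_ders_of_mem_filt hf hs)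

end Words

/-! ### The product over `L(n)` annihilates `revEuler` in degree `n`. -/

section Annihilation

variable {K : Type*} [Field K] {X : Type*} {n a : ℕ} {f : List X → K}

theorem aeval_revEuler_mem_filt (p : K[X]) (hf : f ∈ filt K X n a) :
    aeval revEuler p f ∈ filt K X n a := by
  induction p using Polynomial.induction_on' with
  | add p q hp hq =>
    rw [map_add, LinearMap.add_apply]
    exact add_mem hp hq
  | monomial k c =>
    rw [aeval_monomial, Algebra.algebraMap_eq_smul_one, smul_one_mul, LinearMap.smul_apply]
    refine Submodule.smul_mem _ _ ?_
    induction k with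
    | zero => exact hf
    | succ k ih =>
      rw [pow_succ', Module.End.mul_apply]
      exact revEuler_mem_filt ih

theorem mem_filt_one_iff : f ∈ filt K X n 1 ↔
    (∀ w : List X, w.length ≠ n → f w = 0) ∧ ∀ i, der i f = 0 := by
  refine ⟨fun h => ⟨h.1, fun i => h.2 [i] rfl⟩, fun h => ⟨h.1, fun s hs => ?_⟩⟩
  obtain ⟨i, rfl⟩ := List.length_eq_one_iff.1 hs
  exact h.2 i

/-- On the layer, `revEuler` acts through `ders s` as the scalar `ε * a`, so polynomials in it act
by evaluation; this detects roots of annihilating polynomials. -/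
theorem ders_aeval_revEuler {ε : K} {s : List X} (hf : f ∈ filt K X n (a + 1)) (hs : s.length = a)
    (h : rev (ders s f) = ε • ders s f) (p : K[X]) :
    ders s (aeval revEuler p f) = p.eval (ε * a) • ders s f := by
  induction p using Polynomial.induction_on' with
  | add p q hp hq =>
    rw [map_add, LinearMap.add_apply, map_add, hp, hq, eval_add, add_smul]
  | monomial k c =>
    rw [aeval_monomial, Algebra.algebraMap_eq_smul_one, smul_one_mul, LinearMap.smul_apply,
      map_smul, eval_monomial, mul_smul]
    congr 1
    induction k with
    | zero => simp
    | succ k ih =>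
      have hk : (revEuler ^ k) f ∈ filt K X n (a + 1) := by
        simpa using aeval_revEuler_mem_filt (Polynomial.X ^ k) hf
      rw [pow_succ', Module.End.mul_apply, ders_revEuler hk hs, ih, map_smul, h]
      module

/-- The elements of `L(n)` of absolute value `a` are exactly the eigenvalues allowed by the degree
`n - a` of the constants, so their factors push layer `a` down one step. -/
theorem aeval_prod_filter_eq (hn : 1 < n) (ha : a ≤ n) (hf : f ∈ filt K X n (a + 1)) :
    aeval revEuler (∏ m ∈ (specSet n).filter (fun m => m.natAbs = a),
      (Polynomial.X - C (m : K))) f ∈ filt K X n a := by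
  have key (s : Finset ℤ) (hs : (specSet n).filter (fun m => m.natAbs = a) = s)
      (h : aeval revEuler (∏ m ∈ s, (Polynomial.X - C (m : K))) f ∈ filt K X n a) :
      aeval revEuler (∏ m ∈ (specSet n).filter (fun m => m.natAbs = a),
        (Polynomial.X - C (m : K))) f ∈ filt K X n a := by
    rwa [hs]
  have single (m : ℤ) : aeval revEuler (∏ m ∈ {m}, (Polynomial.X - C (m : K))) f =
      revEuler f - (m : K) • f := by
    rw [Finset.prod_singleton, map_sub, aeval_X, aeval_C, LinearMap.sub_apply,
      Module.algebraMap_end_apply]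
  have mem (m : ℤ) : m ∈ specSet n ↔
      m = -n + 2 ∨ (-n + 4 ≤ m ∧ m ≤ n - 3) ∨ m = 0 ∨ m = n := by
    simp only [specSet, Finset.mem_union, Finset.mem_singleton, Finset.mem_Icc, or_assoc]
  rcases Nat.eq_zero_or_pos a with rfl | hpos
  · refine key {0} (by ext m; simp only [Finset.mem_filter, mem, Finset.mem_singleton]; omega) ?_
    rw [single, revEuler_mem_filt_zero hf]
    simp
  obtain rfl | rfl | rfl | rfl | h4 : n = a ∨ n = a + 1 ∨ n = a + 2 ∨ n = a + 3 ∨ a + 4 ≤ n := by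
    omega
  · refine key {(n : ℤ)} (by ext m; simp only [Finset.mem_filter, mem, Finset.mem_singleton]; omega)
      ?_
    rw [single]
    exact_mod_cast revEuler_sub_mem_filt_top hf
  · refine key ∅ (Finset.filter_eq_empty_iff.2 fun m hm => by rw [mem] at hm; omega) ?_
    simpa using mem_filt_of_mem_filt_add_one hf
  · refine key {-(a : ℤ)}
      (by ext m; simp only [Finset.mem_filter, mem, Finset.mem_singleton]; omega) ?_
    rw [single]
    simpa using revEuler_add_mem_filt hf
  · refine key {(a : ℤ)}
      (by ext m; simp only [Finset.mem_filter, mem, Finset.mem_singleton]; omega) ?_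
    rw [single]
    simpa using revEuler_sub_mem_filt hf
  · refine key {(a : ℤ), -(a : ℤ)}
      (by
        ext m
        simp only [Finset.mem_filter, mem, Finset.mem_singleton, Finset.mem_insert]
        omega) ?_
    rw [Finset.prod_pair (by omega)]
    convert revEuler_revEuler_sub_mem_filt hf using 1
    simp only [map_mul, map_sub, aeval_X, aeval_C, Module.End.mul_apply, LinearMap.sub_apply,
      Module.algebraMap_end_apply, map_smul, Int.cast_neg, Int.cast_natCast]
    module

theorem aeval_revEuler_prod_specSet (hn : 1 < n) (hf : ∀ w : List X, w.length ≠ n → f w = 0) :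
    aeval revEuler (∏ m ∈ specSet n, (Polynomial.X - C (m : K))) f = 0 := by
  have main (a : ℕ) (ha : a ≤ n + 1) : ∀ f ∈ filt K X n a,
      aeval revEuler (∏ m ∈ (specSet n).filter (fun m => m.natAbs < a),
        (Polynomial.X - C (m : K))) f = 0 := by
    induction a with
    | zero =>
      intro f hf
      rw [filt_zero_eq_bot, Submodule.mem_bot] at hf
      rw [hf, map_zero]
    | succ a ih =>
      intro f hf
      have h : (specSet n).filter (fun m => m.natAbs < a + 1) =
          (specSet n).filter (fun m => m.natAbs < a) ∪
            (specSet n).filter (fun m => m.natAbs = a) := by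
        rw [← Finset.filter_or]
        simp only [Nat.lt_succ_iff_lt_or_eq]
      rw [h, Finset.prod_union (Finset.disjoint_filter.2 fun m _ h1 h2 => by omega), map_mul,
        Module.End.mul_apply]
      exact ih (by omega) _ (aeval_prod_filter_eq hn (by omega) hf)
  have h : (specSet n).filter (fun m => m.natAbs < n + 1) = specSet n := by
    refine Finset.filter_true_of_mem fun m hm => ?_
    simp only [specSet, Finset.mem_union, Finset.mem_singleton, Finset.mem_Icc] at hm
    omega
  have := main (n + 1) le_rfl f (mem_filt_of_supported hf)
  rwa [h] at this

end Annihilation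

/-! ### Constants with prescribed reversal sign, and necessity of every root. -/

section Witnesses

variable {K : Type*} [Field K] {X : Type*} [DecidableEq X] {n a : ℕ} {f : List X → K}

/-- Multiplication by the letter `i` from the left. -/
def consMul (i : X) : Module.End K (List X → K) where
  toFun f
    | [] => 0
    | x :: w => if x = i then f w else 0
  map_add' f g := by
    funext w
    cases w <;> simp [ite_add_ite]
  map_smul' c f := by
    funext w
    cases w <;> simp

theorem consMul_nil (i : X) (f : List X → K) : consMul i f [] = 0 := rfl

theorem consMul_cons (i x : X) (f : List X → K) (w : List X) :
    consMul i f (x :: w) = if x = i then f w else 0 := rfl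

theorem der_consMul (j i : X) (f : List X → K) :
    der j (consMul i f) = consMul i (der j f) + if j = i then f else 0 := by
  funext w
  cases w with
  | nil =>
    rw [der_nil, consMul_cons, Pi.add_apply, consMul_nil, zero_add]
    split_ifs <;> rfl
  | cons x w =>
    have h : (fun v => consMul i f (x :: v)) = if x = i then f else 0 := by
      funext v
      rw [consMul_cons]
      split_ifs <;> rfl
    rw [der_cons, h, consMul_cons, Pi.add_apply, consMul_cons, add_comm]
    congr 1
    · split_ifs
      · rfl
      · rw [map_zero]; rfl
    · split_ifs <;> rfl

/-- Multiplication by the letter `i` from the right. -/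
def snocMul (i : X) : Module.End K (List X → K) := rev * consMul i * rev

theorem snocMul_apply (i : X) (f : List X → K) : snocMul i f = rev (consMul i (rev f)) := rfl

theorem der_snocMul (j i : X) (f : List X → K) :
    der j (snocMul i f) = snocMul i (der j f) + if j = i then f else 0 := by
  rw [snocMul_apply, der_rev, der_consMul, der_rev, map_add, snocMul_apply]
  congr 1
  split_ifs
  · exact rev_rev f
  · exact map_zero _

theorem snocMul_append_singleton (i x : X) (f : List X → K) (w : List X) :
    snocMul i f (w ++ [x]) = if x = i then f w else 0 := by
  simp [snocMul_apply, rev_apply, consMul_cons]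

theorem consMul_supported (i : X) (hf : ∀ w : List X, w.length ≠ n → f w = 0) (w : List X)
    (hw : w.length ≠ n + 1) : consMul i f w = 0 := by
  cases w with
  | nil => rfl
  | cons x w => rw [consMul_cons, hf w (by simpa using hw), ite_self]

theorem snocMul_supported (i : X) (hf : ∀ w : List X, w.length ≠ n → f w = 0) (w : List X)
    (hw : w.length ≠ n + 1) : snocMul i f w = 0 :=
  consMul_supported i (fun v hv => hf _ (by simpa using hv)) _ (by simpa using hw)

theorem ders_consMul (i : X) (hf : ∀ s : List X, s.length = a → ders s f = 0) (s : List X)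
    (hs : s.length = a + 1) : ders s (consMul i f) = 0 := by
  induction a generalizing f s with
  | zero => rw [show f = 0 from hf [] rfl, map_zero, map_zero]
  | succ a ih =>
    cases s with
    | nil => simp at hs
    | cons j s =>
      have hs' : s.length = a + 1 := by simpa using hs
      rw [ders_cons, der_consMul, map_add, ih (fun t ht => hf (j :: t) (by simp [ht])) s hs',
        zero_add]
      split_ifs
      · exact hf s hs'
      · exact map_zero _

theorem consMul_mem_filt (i : X) (hf : f ∈ filt K X n a) :
    consMul i f ∈ filt K X (n + 1) (a + 1) :=
  ⟨consMul_supported i hf.1, ders_consMul i hf.2⟩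

theorem consMul_pow_mem_filt (i : X) (k : ℕ) (hf : f ∈ filt K X n a) :
    (consMul i ^ k) f ∈ filt K X (n + k) (a + k) := by
  induction k with
  | zero => exact hf
  | succ k ih => rw [pow_succ', Module.End.mul_apply]; exact consMul_mem_filt i ih

theorem der_consMul_pow (i : X) (k : ℕ) (hf : der i f = 0) :
    der i ((consMul i ^ (k + 1)) f) = (k + 1 : K) • (consMul i ^ k) f := by
  induction k with
  | zero => simp [der_consMul, hf]
  | succ k ih =>
    rw [pow_succ', Module.End.mul_apply, der_consMul, ih, if_pos rfl, map_smul,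
      ← Module.End.mul_apply (consMul i), ← pow_succ']
    push_cast
    module

theorem ders_consMul_pow (i : X) (k : ℕ) (hf : der i f = 0) :
    ders (List.replicate k i) ((consMul i ^ k) f) = (k.factorial : K) • f := by
  induction k with
  | zero => simp [ders_nil]
  | succ k ih =>
    rw [List.replicate_succ, ders_cons, der_consMul_pow i k hf, map_smul, ih, smul_smul,
      Nat.factorial_succ]
    push_cast
    rfl

/-- The commutator of a letter with `f`. -/
def adLetter (i : X) : Module.End K (List X → K) := consMul i - snocMul i

theorem adLetter_apply (i : X) (f : List X → K) : adLetter i f = consMul i f - snocMul i f := rfl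

/-- Left and right multiplication by a letter obey the same Leibniz rule, so the extra terms cancel
in the commutator. -/
theorem adLetter_mem_filt (i : X) (hf : f ∈ filt K X n 1) :
    adLetter i f ∈ filt K X (n + 1) 1 := by
  rw [mem_filt_one_iff] at hf ⊢
  refine ⟨fun w hw => ?_, fun j => ?_⟩
  · simp [adLetter_apply, consMul_supported i hf.1 w hw, snocMul_supported i hf.1 w hw]
  · simp [adLetter_apply, der_consMul, der_snocMul, hf.2]

theorem rev_adLetter (i : X) (f : List X → K) : rev (adLetter i f) = -adLetter i (rev f) := by
  simp [adLetter_apply, snocMul_apply, rev_rev]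

/-- Multiplication by the commutator of two letters from the left. -/
def commMul (i j : X) : Module.End K (List X → K) :=
  consMul i * consMul j - consMul j * consMul i

theorem commMul_apply (i j : X) (f : List X → K) :
    commMul i j f = consMul i (consMul j f) - consMul j (consMul i f) := rfl

theorem commMul_mem_filt (i j : X) (hf : f ∈ filt K X n 1) :
    commMul i j f ∈ filt K X (n + 2) 1 := by
  rw [mem_filt_one_iff] at hf ⊢
  refine ⟨fun w hw => ?_, fun k => ?_⟩
  · simp [commMul_apply, consMul_supported i (consMul_supported j hf.1) w hw,
      consMul_supported j (consMul_supported i hf.1) w hw]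
  · simp only [commMul_apply, map_sub, der_consMul, hf.2, map_zero, zero_add]
    split_ifs <;> rw [sub_eq_zero] <;> simp [add_comm]

/-- The commutator of two letters. -/
def commLetters (K : Type*) [Field K] (i j : X) : List X → K :=
  commMul i j fun w => if w = [] then 1 else 0

theorem commLetters_mem_filt (i j : X) : commLetters K i j ∈ filt K X 2 1 := by
  have h (w : List X) (hw : w.length ≠ 0) : (if w = [] then 1 else 0 : K) = 0 := by
    rw [if_neg (by rintro rfl; simp at hw)]
  refine commMul_mem_filt (n := 0) i j (mem_filt_one_iff.2 ⟨h, fun k => ?_⟩)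
  exact funext fun w => der_supported k h w (by omega)

theorem commLetters_apply_self {i j : X} (h : i ≠ j) : commLetters K i j [i, j] = 1 := by
  simp [commLetters, commMul_apply, consMul_cons, h]

theorem rev_commLetters (i j : X) : rev (commLetters K i j) = -commLetters K i j :=
  rev_eq_neg_of_der_eq_zero (commLetters_mem_filt i j).1
    (mem_filt_one_iff.1 (commLetters_mem_filt i j)).2

theorem adLetter_pow_commLetters_mem_filt (i j : X) (k : ℕ) :
    (adLetter i ^ k) (commLetters K i j) ∈ filt K X (k + 2) 1 := by
  induction k with
  | zero => exact commLetters_mem_filt i j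
  | succ k ih => rw [pow_succ', Module.End.mul_apply]; exact adLetter_mem_filt i ih

theorem adLetter_pow_commLetters_apply {i j : X} (h : i ≠ j) (k : ℕ) :
    (adLetter i ^ k) (commLetters K i j) (List.replicate (k + 1) i ++ [j]) = 1 := by
  induction k with
  | zero => exact commLetters_apply_self h
  | succ k ih =>
    rw [pow_succ', Module.End.mul_apply, adLetter_apply, Pi.sub_apply, snocMul_append_singleton,
      if_neg h.symm, List.replicate_succ, List.cons_append, consMul_cons, if_pos rfl, ih, sub_zero]

theorem exists_rev_eq_smul (m : ℕ) (ε : K) (h : (m = 0 ∧ ε = 1) ∨ (m = 2 ∧ ε = -1) ∨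
    (m = 3 ∧ ε = 1) ∨ (4 ≤ m ∧ (ε = 1 ∨ ε = -1))) :
    ∃ u ∈ filt K (Fin 4) m 1, rev u = ε • u ∧ u ≠ 0 := by
  obtain ⟨rfl, rfl⟩ | ⟨rfl, rfl⟩ | ⟨rfl, rfl⟩ | ⟨hm, hε⟩ := h
  · have h (w : List (Fin 4)) (hw : w.length ≠ 0) : (if w = [] then 1 else 0 : K) = 0 := by
      rw [if_neg (by rintro rfl; simp at hw)]
    refine ⟨_, mem_filt_of_supported h, ?_, fun h => by simpa using congrFun h []⟩
    funext w
    simp [rev_apply]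
  · refine ⟨_, commLetters_mem_filt 0 1, ?_, fun h => ?_⟩
    · rw [rev_commLetters, neg_one_smul]
    · have := congrFun h [0, 1]
      rw [commLetters_apply_self (by decide)] at this
      exact one_ne_zero this
  · refine ⟨_, adLetter_pow_commLetters_mem_filt 0 1 1, ?_, fun h => ?_⟩
    · rw [pow_one, rev_adLetter, rev_commLetters, map_neg, neg_neg, one_smul]
    · have := congrFun h (List.replicate 2 0 ++ [1])
      rw [adLetter_pow_commLetters_apply (by decide)] at this
      exact one_ne_zero this
  -- The product `g = [x_0, x_1] · ad(x_2)^k [x_2, x_3]` of constants is constant, and `g + ε rev g`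
  -- has sign `ε`. It is nonzero: at the word `0 1 2 … 2 3`, `g` is `1`, while `rev g` is `0` since
  -- the reversed word starts with `3`.
  · obtain ⟨k, rfl⟩ := Nat.exists_eq_add_of_le' hm
    have hg := commMul_mem_filt (0 : Fin 4) 1
      (adLetter_pow_commLetters_mem_filt (K := K) (2 : Fin 4) 3 k)
    set g := commMul (0 : Fin 4) 1 ((adLetter 2 ^ k) (commLetters K 2 3)) with hgdef
    refine ⟨g + ε • rev g, add_mem hg (Submodule.smul_mem _ _ (rev_mem_filt hg)), ?_, fun h => ?_⟩
    · rw [map_add, map_smul, rev_rev, smul_add, smul_smul]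
      obtain rfl | rfl := hε <;> simp [add_comm]
    · have h1 := congrFun h (0 :: 1 :: (List.replicate (k + 1) 2 ++ [3]))
      have h2 : g (0 :: 1 :: (List.replicate (k + 1) 2 ++ [3])) = 1 := by
        rw [hgdef, commMul_apply, Pi.sub_apply]
        simp only [consMul_cons]
        rw [adLetter_pow_commLetters_apply (by decide)]
        simp
      have h3 : rev g (0 :: 1 :: (List.replicate (k + 1) 2 ++ [3])) = 0 := by
        rw [hgdef, rev_apply, commMul_apply, Pi.sub_apply]
        simp [consMul_cons]
      rw [Pi.add_apply, Pi.smul_apply, h2, h3] at h1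
      simp at h1

theorem eval_eq_zero_of_aeval_revEuler_eq_zero [CharZero K] (m : ℕ) (ε : K)
    (h : (m = 0 ∧ ε = 1) ∨ (m = 2 ∧ ε = -1) ∨ (m = 3 ∧ ε = 1) ∨ (4 ≤ m ∧ (ε = 1 ∨ ε = -1)))
    (p : K[X]) (hp : ∀ f : List (Fin 4) → K, (∀ w, w.length ≠ m + a → f w = 0) →
      aeval revEuler p f = 0) : p.eval (ε * a) = 0 := by
  obtain ⟨u, hu, hrev, hne⟩ := exists_rev_eq_smul m ε h
  have hv := consMul_pow_mem_filt 0 a hu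
  have hd := ders_consMul_pow 0 a ((mem_filt_one_iff.1 hu).2 0)
  rw [add_comm 1 a] at hv
  have := ders_aeval_revEuler hv (List.length_replicate (n := a) (a := (0 : Fin 4))) (ε := ε)
    (by rw [hd, map_smul, hrev, smul_comm]) p
  rw [hp _ hv.1, map_zero, hd, eq_comm, smul_eq_zero, smul_eq_zero] at this
  simpa [hne, Nat.factorial_ne_zero] using this

theorem eval_eq_zero_of_mem_specSet [CharZero K] (hn : 1 < n) (p : K[X])
    (hp : ∀ f : List (Fin 4) → K, (∀ w, w.length ≠ n → f w = 0) → aeval revEuler p f = 0)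
    {m : ℤ} (hm : m ∈ specSet n) : p.eval (m : K) = 0 := by
  -- Here `d` is the degree of the constant and `a` the number of letters `0` placed before it.
  have main (a d : ℕ) (ε : ℤ) (hd : d + a = n) (hε : ε * a = m)
      (h : (d = 0 ∧ ε = 1) ∨ (d = 2 ∧ ε = -1) ∨ (d = 3 ∧ ε = 1) ∨
        (4 ≤ d ∧ (ε = 1 ∨ ε = -1))) : p.eval (m : K) = 0 := by
    subst hd hε
    push_cast
    refine eval_eq_zero_of_aeval_revEuler_eq_zero d (ε : K) ?_ p hp
    obtain ⟨h, rfl⟩ | ⟨h, rfl⟩ | ⟨h, rfl⟩ | ⟨h, rfl | rfl⟩ := h <;> simp [h]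
  simp only [specSet, Finset.mem_union, Finset.mem_singleton, Finset.mem_Icc] at hm
  by_cases h0 : m = 0
  -- For `m = 0` the sign is irrelevant to the root, but must be one realised by a constant of
  -- degree `n`; degree `2` forces `-1`.
  · obtain h | h | h : n = 2 ∨ n = 3 ∨ 4 ≤ n := by omega
    · exact main 0 n (-1) (by omega) (by simp [h0]) (by omega)
    · exact main 0 n 1 (by omega) (by simp [h0]) (by omega)
    · exact main 0 n 1 (by omega) (by simp [h0]) (by omega)
  · rcases le_total 0 m with h | h
    · exact main m.natAbs (n - m.natAbs) 1 (by omega) (by omega) (by omega)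
    · exact main m.natAbs (n - m.natAbs) (-1) (by omega) (by omega) (by omega)

end Witnesses

/-! ### Transfer between the group algebra and word functions. -/

section Representation

/-- The group algebra of the symmetric group acting on the functions on words of length `n` by
permuting the positions. -/
noncomputable def posRep (K X : Type*) [Field K] (n : ℕ) :
    SymAlg K n →ₐ[K] Module.End K ((Fin n → X) → K) :=
  MonoidAlgebra.lift K (Module.End K ((Fin n → X) → K)) (Equiv.Perm (Fin n))
    { toFun g :=
        { toFun f w := f (w ∘ g)
          map_add' _ _ := rfl
          map_smul' _ _ := rfl }
      map_one' := rfl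
      map_mul' _ _ := rfl }

variable {K : Type*} [Field K] {X : Type*} {n : ℕ}

theorem posRep_of (g : Equiv.Perm (Fin n)) (f : (Fin n → X) → K) (w : Fin n → X) :
    posRep K X n (MonoidAlgebra.of K _ g) f w = f (w ∘ g) := by
  rw [posRep, MonoidAlgebra.lift_of]
  rfl

theorem posRep_apply (x : SymAlg K n) (f : (Fin n → X) → K) (w : Fin n → X) :
    posRep K X n x f w = ∑ g, x.coeff g * f (w ∘ g) := by
  rw [posRep, MonoidAlgebra.lift_apply, Finsupp.sum_fintype _ _ (by simp), LinearMap.sum_apply,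
    Finset.sum_apply]
  rfl

/-- Restriction of a function on words to the words of length `n`. -/
def restrictLength (K X : Type*) [Field K] (n : ℕ) :
    (List X → K) →ₗ[K] (Fin n → X) → K where
  toFun f w := f (List.ofFn w)
  map_add' _ _ := rfl
  map_smul' _ _ := rfl

theorem restrictLength_apply (f : List X → K) (w : Fin n → X) :
    restrictLength K X n f w = f (List.ofFn w) := rfl

theorem der_ofFn (i : X) (f : List X → K) (w : Fin n → X) :
    der i f (List.ofFn w) = ∑ j : Fin (n + 1), f (List.ofFn (Fin.insertNth j i w : Fin (n + 1) → X))
      := by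
  induction n generalizing f with
  | zero => simp [der_nil]
  | succ n ih =>
    obtain ⟨x, v, rfl⟩ : ∃ x v, w = Fin.cons x v := ⟨w 0, Fin.tail w, (Fin.cons_self_tail w).symm⟩
    rw [Fin.sum_univ_succ, Fin.insertNth_zero', List.ofFn_cons, List.ofFn_cons, List.ofFn_cons,
      der_cons, ih]
    simp only [Fin.insertNth_succ_cons, List.ofFn_cons]

/-- Composing a word with the cycle on the first `i` positions moves its first letter to position
`i`; summing over `i` inserts that letter everywhere into the rest. -/
theorem posRep_topToRandom (f : List X → K) :
    posRep K X n (topToRandom K n) (restrictLength K X n f) =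
      restrictLength K X n (euler f) := by
  funext w
  rw [topToRandom, map_sum, LinearMap.sum_apply, Finset.sum_apply]
  simp only [posRep_of, restrictLength_apply]
  cases n with
  | zero => simp [euler_nil]
  | succ n =>
    obtain ⟨x, v, rfl⟩ : ∃ x v, w = Fin.cons x v := ⟨w 0, Fin.tail w, (Fin.cons_self_tail w).symm⟩
    simp only [Fin.cons_comp_cycleRange]
    rw [List.ofFn_cons, euler_cons, der_ofFn]

theorem posRep_longest (f : List X → K) :
    posRep K X n (longest K n) (restrictLength K X n f) = restrictLength K X n (rev f) := by
  funext w
  rw [longest, posRep_of, restrictLength_apply, restrictLength_apply, rev_apply]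
  congr 1
  refine List.ext_getElem (by simp) fun k h1 h2 => ?_
  simp only [List.length_ofFn] at h1
  simp only [List.getElem_ofFn, List.getElem_reverse, List.length_ofFn, Function.comp_apply,
    Fin.revPerm_apply]
  congr 1
  ext
  simp
  omega

theorem posRep_longest_mul_topToRandom (f : List X → K) :
    posRep K X n (longest K n * topToRandom K n) (restrictLength K X n f) =
      restrictLength K X n (revEuler f) := by
  rw [map_mul, Module.End.mul_apply, posRep_topToRandom, posRep_longest, revEuler_apply]

theorem posRep_aeval (p : K[X]) (f : List X → K) :
    posRep K X n (aeval (longest K n * topToRandom K n) p) (restrictLength K X n f) =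
      restrictLength K X n (aeval revEuler p f) := by
  rw [← aeval_algHom_apply]
  induction p using Polynomial.induction_on' with
  | add p q hp hq => simp only [map_add, LinearMap.add_apply, hp, hq]
  | monomial k c =>
    simp only [aeval_monomial, Module.End.mul_apply, Module.algebraMap_end_apply, map_smul]
    congr 1
    induction k with
    | zero => rfl
    | succ k ih =>
      rw [pow_succ', pow_succ', Module.End.mul_apply, Module.End.mul_apply, ih,
        posRep_longest_mul_topToRandom]

/-- On `n` distinct letters the action is faithful: evaluating at the word `id`, the indicator of
the word `u` reads off the coefficient of `u`. -/
theorem eq_zero_of_posRep_eq_zero (x : SymAlg K n)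
    (hx : ∀ f : List (Fin n) → K, (∀ w, w.length ≠ n → f w = 0) →
      posRep K (Fin n) n x (restrictLength K (Fin n) n f) = 0) : x = 0 := by
  ext u
  have := congrFun (hx (fun w => if w = List.ofFn u then 1 else 0) fun w hw => by
    rw [if_neg (by rintro rfl; simp at hw)]) id
  rw [posRep_apply, Finset.sum_eq_single u] at this
  · simpa [restrictLength_apply] using this
  · intro g _ hg
    rw [restrictLength_apply, if_neg, mul_zero]
    exact fun h => hg (DFunLike.coe_injective (List.ofFn_injective h))
  · simp

end Representation

/-! ### Minimal polynomials of `w₀A`, `Aw₀` and their multiplication operators. -/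

section MinimalPolynomial

variable {K : Type*} [Field K] {n : ℕ}

theorem aeval_prod_specSet (hn : 1 < n) :
    aeval (longest K n * topToRandom K n) (∏ m ∈ specSet n, (X - C (m : K))) = 0 := by
  refine eq_zero_of_posRep_eq_zero _ fun f hf => ?_
  rw [posRep_aeval, aeval_revEuler_prod_specSet hn hf, map_zero]

theorem eval_eq_zero_of_aeval_eq_zero [CharZero K] (hn : 1 < n) {p : K[X]}
    (hp : aeval (longest K n * topToRandom K n) p = 0) {m : ℤ} (hm : m ∈ specSet n) :
    p.eval (m : K) = 0 := by
  refine eval_eq_zero_of_mem_specSet hn p (fun f hf => ?_) hm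
  have h := (aeval_revEuler_mem_filt p (mem_filt_of_supported hf)).1
  funext w
  by_cases hw : w.length = n
  · subst hw
    have := congrFun (posRep_aeval (n := w.length) p f) w.get
    rw [hp, map_zero, restrictLength_apply, List.ofFn_get] at this
    exact this.symm
  · exact h w hw

theorem prod_X_sub_C_eq_minpoly_of_forall_eval [CharZero K] {A : Type*} [Ring A] [Algebra K A]
    {x : A} {L : Finset ℤ} (h : aeval x (∏ m ∈ L, (X - C (m : K))) = 0)
    (h' : ∀ m ∈ L, (minpoly K x).eval (m : K) = 0) :
    minpoly K x = ∏ m ∈ L, (X - C (m : K)) := by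
  have hmonic : (∏ m ∈ L, (X - C (m : K))).Monic := monic_prod_X_sub_C _ _
  have hint : IsIntegral K x := ⟨_, hmonic, by rwa [← aeval_def]⟩
  refine eq_of_monic_of_associated (minpoly.monic hint) hmonic
    (associated_of_dvd_dvd (minpoly.dvd K x h) (Finset.prod_dvd_of_coprime ?_ ?_))
  · exact fun a _ b _ hab => pairwise_coprime_X_sub_C Int.cast_injective hab
  · exact fun m hm => dvd_iff_isRoot.2 (h' m hm)

theorem minpoly_longest_mul_topToRandom [CharZero K] (hn : 1 < n) :
    minpoly K (longest K n * topToRandom K n) = ∏ m ∈ specSet n, (X - C (m : K)) :=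
  prod_X_sub_C_eq_minpoly_of_forall_eval (aeval_prod_specSet hn)
    fun _ hm => eval_eq_zero_of_aeval_eq_zero hn (minpoly.aeval _ _) hm

theorem longest_mul_longest : longest K n * longest K n = 1 := by
  rw [longest, ← map_mul, ← map_one (MonoidAlgebra.of K (Equiv.Perm (Fin n)))]
  congr 1
  ext i
  simp

theorem minpoly_eq_of_forall_aeval_eq_zero_iff {A B : Type*} [Ring A] [Algebra K A] [Ring B]
    [Algebra K B] {x : A} {y : B} (hx : IsIntegral K x)
    (h : ∀ p : K[X], aeval x p = 0 ↔ aeval y p = 0) : minpoly K x = minpoly K y := by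
  have hy : IsIntegral K y :=
    ⟨_, minpoly.monic hx, by rw [← aeval_def, ← h, minpoly.aeval]⟩
  exact eq_of_monic_of_associated (minpoly.monic hx) (minpoly.monic hy)
    (associated_of_dvd_dvd (minpoly.dvd K x ((h _).2 (minpoly.aeval K y)))
      (minpoly.dvd K y ((h _).1 (minpoly.aeval K x))))

theorem minpoly_mul_comm_of_mul_self_eq_one {A : Type*} [Ring A] [Algebra K A] {u : A}
    (hu : u * u = 1) (x : A) : minpoly K (x * u) = minpoly K (u * x) := by
  -- Conjugation by the involution `u` sends `u * x` to `x * u`.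
  let e : A ≃ₐ[K] A := MulSemiringAction.toAlgEquiv K A (ConjAct.toConjAct (⟨u, u, hu, hu⟩ : Aˣ))
  have h : e (u * x) = x * u := by
    change u * (u * x) * u = x * u
    rw [← mul_assoc, hu, one_mul]
  rw [← h, minpoly.algEquiv_eq]

theorem minpoly_topToRandom_mul_longest [CharZero K] (hn : 1 < n) :
    minpoly K (topToRandom K n * longest K n) = ∏ m ∈ specSet n, (X - C (m : K)) := by
  rw [minpoly_mul_comm_of_mul_self_eq_one longest_mul_longest, minpoly_longest_mul_topToRandom hn]

theorem minpoly_mulLeft {A : Type*} [Ring A] [Algebra K A] {x : A} :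
    minpoly K (LinearMap.mulLeft K x) = minpoly K x :=
  minpoly.algHom_eq (Algebra.lmul K A) Algebra.lmul_injective x

theorem aeval_mulRight_apply {A : Type*} [Ring A] [Algebra K A] (x y : A) (p : K[X]) :
    aeval (LinearMap.mulRight K x) p y = y * aeval x p := by
  induction p using Polynomial.induction_on' with
  | add p q hp hq => simp only [map_add, LinearMap.add_apply, hp, hq, mul_add]
  | monomial k c =>
    simp [aeval_monomial, Module.algebraMap_end_apply, LinearMap.pow_mulRight,
      Algebra.smul_def, Algebra.left_comm]

theorem minpoly_mulRight {A : Type*} [Ring A] [Algebra K A] {x : A} (hx : IsIntegral K x) :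
    minpoly K (LinearMap.mulRight K x) = minpoly K x := by
  refine (minpoly_eq_of_forall_aeval_eq_zero_iff hx fun p => ⟨fun h => ?_, fun h => ?_⟩).symm
  · ext y
    rw [aeval_mulRight_apply, h, mul_zero, LinearMap.zero_apply]
  · have := aeval_mulRight_apply x 1 p
    rwa [h, LinearMap.zero_apply, one_mul, eq_comm] at this

end MinimalPolynomial

/-! ### Diagonalizability from a minimal polynomial with distinct roots. -/

section Diagonalizable

variable {K V : Type*} [Field K] [AddCommGroup V] [Module K V] {f : Module.End K V}

/-- Distinct integers stay distinct in `K`, so the factors are coprime and the kernel splits as a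
sum of eigenspaces. -/
theorem ker_aeval_prod_le_iSup_eigenspace [CharZero K] (L : Finset ℤ) :
    LinearMap.ker (aeval f (∏ m ∈ L, (X - C (m : K)))) ≤ ⨆ c, f.eigenspace c := by
  induction L using Finset.induction_on with
  | empty => simp [Module.End.one_eq_id]
  | insert m L hm ih =>
    rw [Finset.prod_insert hm, ← sup_ker_aeval_eq_ker_aeval_mul_of_coprime]
    · refine sup_le (le_trans (fun v hv => ?_) (le_iSup _ (m : K))) ih
      rw [Module.End.mem_eigenspace_iff]
      rwa [LinearMap.mem_ker, map_sub, aeval_X, aeval_C, LinearMap.sub_apply,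
        Module.algebraMap_end_apply, sub_eq_zero] at hv
    · refine IsCoprime.prod_right fun a ha => ?_
      exact pairwise_coprime_X_sub_C Int.cast_injective (by rintro rfl; exact hm ha)

theorem isDiagonalizable_of_iSup_eigenspace_eq_top (h : ⨆ c, f.eigenspace c = ⊤) :
    IsDiagonalizable f := by
  classical
  have hint := DirectSum.isInternal_submodule_of_iSupIndep_of_iSup_eq_top
    f.eigenspaces_iSupIndep h
  let b := hint.collectedBasis fun c => Module.Basis.ofVectorSpace K (f.eigenspace c)
  refine ⟨_, b.reindexRange, ?_⟩
  rintro ⟨_, i, rfl⟩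
  refine ⟨i.1, ?_⟩
  rw [Module.Basis.reindexRange_self]
  exact Module.End.mem_eigenspace_iff.1 (hint.collectedBasis_mem _ i)

theorem diagonalizableWithEigenvalues_of_minpoly_eq [CharZero K] [FiniteDimensional K V]
    {L : Finset ℤ} (h : minpoly K f = ∏ m ∈ L, (X - C (m : K))) :
    DiagonalizableWithEigenvalues f L := by
  refine ⟨isDiagonalizable_of_iSup_eigenspace_eq_top (top_le_iff.1 ?_), fun c => ?_⟩
  · refine le_trans (fun v _ => ?_) (ker_aeval_prod_le_iSup_eigenspace L)
    rw [← h, LinearMap.mem_ker, minpoly.aeval, LinearMap.zero_apply]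
  · rw [Module.End.hasEigenvalue_iff_isRoot, h, IsRoot, eval_prod, Finset.prod_eq_zero_iff]
    simp [sub_eq_zero, eq_comm]

end Diagonalizable

end RevTopToRandom

theorem mainTheorem1 (K : Type*) [Field K] [CharZero K] (n : ℕ) (hn : 1 < n) :
    (minpoly K (RevTopToRandom.longest K n * RevTopToRandom.topToRandom K n) =
        ∏ m ∈ RevTopToRandom.specSet n, (X - C (m : K))) ∧
    (minpoly K (RevTopToRandom.topToRandom K n * RevTopToRandom.longest K n) =
        ∏ m ∈ RevTopToRandom.specSet n, (X - C (m : K))) ∧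
    RevTopToRandom.DiagonalizableWithEigenvalues
      (LinearMap.mulLeft K (RevTopToRandom.longest K n * RevTopToRandom.topToRandom K n))
      (RevTopToRandom.specSet n) ∧
    RevTopToRandom.DiagonalizableWithEigenvalues
      (LinearMap.mulRight K (RevTopToRandom.longest K n * RevTopToRandom.topToRandom K n))
      (RevTopToRandom.specSet n) ∧
    RevTopToRandom.DiagonalizableWithEigenvalues
      (LinearMap.mulLeft K (RevTopToRandom.topToRandom K n * RevTopToRandom.longest K n))
      (RevTopToRandom.specSet n) ∧
    RevTopToRandom.DiagonalizableWithEigenvalues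
      (LinearMap.mulRight K (RevTopToRandom.topToRandom K n * RevTopToRandom.longest K n))
      (RevTopToRandom.specSet n) := by
  have h1 := RevTopToRandom.minpoly_longest_mul_topToRandom (K := K) hn
  have h2 := RevTopToRandom.minpoly_topToRandom_mul_longest (K := K) hn
  have : FiniteDimensional K (RevTopToRandom.SymAlg K n) :=
    Module.Finite.of_basis (MonoidAlgebra.basis (Equiv.Perm (Fin n)) K)
  refine ⟨h1, h2, ?_, ?_, ?_, ?_⟩ <;>
    apply RevTopToRandom.diagonalizableWithEigenvalues_of_minpoly_eq
  · rw [RevTopToRandom.minpoly_mulLeft, h1]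
  · rw [RevTopToRandom.minpoly_mulRight (Algebra.IsIntegral.isIntegral _), h1]
  · rw [RevTopToRandom.minpoly_mulLeft, h2]
  · rw [RevTopToRandom.minpoly_mulRight (Algebra.IsIntegral.isIntegral _), h2]
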